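/- Formulas of S4 are built from countably many atoms $P$ and $\bot$ by $\to$ and $\Box$. Sequents $\Gamma\supset\Delta$ consist of two finite multisets of formulas. The system $\mathrm{G3s}$ has the axioms $P,\Gamma\supset\Delta,P$ ($P$ an atom) and $\bot,\Gamma\supset\Delta$, and the rules - $(\to\supset)$: from $\Gamma\supset\Delta,A$ and $B,\Gamma\supset\Delta$ infer $A\to B,\Gamma\supset\Delta$; - $(\supset\to)$: from $A,\Gamma\supset\Delta,B$ infer $\Gamma\supset\Delta,A\to B$; - $(\Box\supset)$: from $A,\Box A,\Gamma\supset\Delta$ infer $\Box A,\Gamma\supset\Delta$; - $(\supset\Box)$: from $\Box\Gamma\supset A$ infer $\Gamma',\Box\Gamma\supset\Delta',\Box A$. $\mathrm{G3s}+(\mathrm{Cut})$ adds to $\mathrm{G3s}$ the rule: from $\Gamma\supset\Delta,A$ and $A,\Gamma\supset\Delta$ infer $\Gamma\supset\Delta$. $\mathrm{G3s}+(\Box\mathrm{Cut})$ adds instead the rule: from $\Gamma\supset\Delta,\Box A,\Box B$ and $\Gamma\supset\Delta,\Box(A\to B),\Box B$ infer $\Gamma\supset\Delta,\Box B$. In a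 proof tree, occurrences of $\Box$ correspond directly as follows. An occurrence in a side formula (repeated context) of a premise corresponds to the same occurrence in that side formula of the conclusion. An occurrence in an active formula of a premise of a $\mathrm{G3s}$ rule corresponds to the same occurrence in the respective subformula of the principal formula (for $(\Box\supset)$, the active $\Box A$ corresponds to the principal $\Box A$, and the active $A$ to its immediate subformula $A$). For $(\mathrm{Cut})$, the two copies of the cut formula $A$ correspond to each other. For $(\Box\mathrm{Cut})$, the topmost $\Box$ of $\Box A$, of $\Box(A\to B)$ and of all three copies of $\Box B$ correspond to each other, as do the two copies of $A$, and all copies of $B$. A *family* of the proof is a class of the equivalence relation on occurrences of $\Box$ generated by direct correspondence. For families $i,j$ of a proof, write $i\prec j$ if some $(\supset\Box)$ rule of the proof introduces, as the topmost symbol of its principal formula, an occurrence of $\Box$ of the family $j$, and an occurrence of $\Box$ of the family $i$ is in the premise of that rule. A *prehistoric cycle* is a finite list of families with $i_0\prec i_1\prec\cdots\prec i_{n-1}\prec i_0$, $n\ge 1$. The *cycle-free fragment* $Y^{\otimes}$ of a system $Y$ is the set of all sequents that have a $Y$-proof without prehistoric cycles. **Theorem.** The cycle-free fragments of the three systems are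 identical: $$(\mathrm{G3s}+(\Box\mathrm{Cut}))^{\otimes}=(\mathrm{G3s}+(\mathrm{Cut}))^{\otimes}=\mathrm{G3s}^{\otimes}.$$ Moreover $\mathrm{G3s}^{\otimes}$ does not change if, in $\mathrm{G3s}$-proofs, $\prec$ is restricted to the principal positive families, that is, the families all of whose occurrences have positive polarity in their sequents and that contain an occurrence introduced by a $(\supset\Box)$ rule. (Relative to a formula, its own topmost $\Box$ is positive, polarity is kept under $\Box$ and in the conclusion of $\to$, and reversed in the premise of $\to$; relative to a sequent, it is kept in formulas on the right and reversed in formulas on the left.) -/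

import Mathlib

namespace G3s

/-- Formulas of S4 in the minimal language `⊥`, `P`, `A → B`, `□ A`. -/
inductive Form : Type
  | bot : Form
  | atom : ℕ → Form
  | imp : Form → Form → Form
  | box : Form → Form

/-- The occurrences of the symbol `□` in a formula. -/
inductive BoxOcc : Form → Type
  | top {A : Form} : BoxOcc (Form.box A)
  | inBox {A : Form} : BoxOcc A → BoxOcc (Form.box A)
  | inLeft {A B : Form} : BoxOcc A → BoxOcc (Form.imp A B)
  | inRight {A B : Form} : BoxOcc B → BoxOcc (Form.imp A B)

/-- An occurrence of `□` in a formula has positive polarity relative to that formula. -/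
def BoxOcc.Positive : {A : Form} → BoxOcc A → Prop
  | _, BoxOcc.top => True
  | _, BoxOcc.inBox o => o.Positive
  | _, BoxOcc.inLeft o => ¬ o.Positive
  | _, BoxOcc.inRight o => o.Positive

/-- The occurrences of `□` in a list of formulas. -/
inductive ListOcc : List Form → Type
  | head {A : Form} {l : List Form} : BoxOcc A → ListOcc (A :: l)
  | tail {A : Form} {l : List Form} : ListOcc l → ListOcc (A :: l)

def ListOcc.Positive : {l : List Form} → ListOcc l → Prop
  | _, ListOcc.head o => o.Positive
  | _, ListOcc.tail o => o.Positive

/-- An occurrence in `l`, seen as an occurrence in `l ++ l'`. -/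
def ListOcc.append : {l : List Form} → (l' : List Form) → ListOcc l → ListOcc (l ++ l')
  | _, _, ListOcc.head o => ListOcc.head o
  | _, l', ListOcc.tail o => ListOcc.tail (o.append l')

/-- A rearrangement of a list, as data: it records which entry goes where, also when the same
formula stands in the list several times. -/
inductive Exch : List Form → List Form → Type
  | nil : Exch [] []
  | cons (A : Form) {l l' : List Form} : Exch l l' → Exch (A :: l) (A :: l')
  | swap (A B : Form) (l : List Form) : Exch (A :: B :: l) (B :: A :: l)
  | trans {l l' l'' : List Form} : Exch l l' → Exch l' l'' → Exch l l''

/-- The action of a rearrangement on occurrences of `□`. -/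
def Exch.map : {l l' : List Form} → Exch l l' → ListOcc l → ListOcc l'
  | _, _, Exch.cons _ _, ListOcc.head o => ListOcc.head o
  | _, _, Exch.cons _ e, ListOcc.tail o => ListOcc.tail (e.map o)
  | _, _, Exch.swap _ _ _, ListOcc.head o => ListOcc.tail (ListOcc.head o)
  | _, _, Exch.swap _ _ _, ListOcc.tail (ListOcc.head o) => ListOcc.head o
  | _, _, Exch.swap _ _ _, ListOcc.tail (ListOcc.tail o) => ListOcc.tail (ListOcc.tail o)
  | _, _, Exch.trans e e', o => e'.map (e.map o)

/-- A sequent `Γ ⊃ Δ` in a proof tree. The two multisets are presented by lists, so that one can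
point at the occurrences of formulas in them. -/
structure Sequent where
  ant : List Form
  suc : List Form

/-- The occurrences of `□` in a sequent. -/
inductive SeqOcc (S : Sequent) : Type
  | ant : ListOcc S.ant → SeqOcc S
  | suc : ListOcc S.suc → SeqOcc S

/-- An occurrence of `□` has positive polarity relative to the sequent. -/
def SeqOcc.Positive {S : Sequent} : SeqOcc S → Prop
  | SeqOcc.ant o => ¬ o.Positive
  | SeqOcc.suc o => o.Positive

/-- The three systems: G3s, G3s + (Cut) and G3s + (□Cut). -/
inductive System : Type
  | g3s
  | cut
  | boxCut

/-- Axioms. -/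
inductive Rule0 : Sequent → Type
  /-- (Ax): `P, Γ ⊃ Δ, P` with `P` atomic. -/
  | ax (P : ℕ) (Γ Δ : List Form) : Rule0 ⟨Form.atom P :: Γ, Form.atom P :: Δ⟩
  /-- (⊥⊃): `⊥, Γ ⊃ Δ`. -/
  | botL (Γ Δ : List Form) : Rule0 ⟨Form.bot :: Γ, Δ⟩

/-- Rules with one premise; `Rule1 S₁ S` has premise `S₁` and conclusion `S`. -/
inductive Rule1 : Sequent → Sequent → Type
  /-- (⊃→): from `A, Γ ⊃ Δ, B` infer `Γ ⊃ Δ, A → B`. -/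
  | impR (A B : Form) (Γ Δ : List Form) :
      Rule1 ⟨A :: Γ, B :: Δ⟩ ⟨Γ, Form.imp A B :: Δ⟩
  /-- (□⊃): from `A, □A, Γ ⊃ Δ` infer `□A, Γ ⊃ Δ`. -/
  | boxL (A : Form) (Γ Δ : List Form) :
      Rule1 ⟨A :: Form.box A :: Γ, Δ⟩ ⟨Form.box A :: Γ, Δ⟩
  /-- (⊃□): from `□Γ ⊃ A` infer `Γ', □Γ ⊃ Δ', □A`. -/
  | boxR (A : Form) (Γ Γ' Δ' : List Form) :
      Rule1 ⟨Γ.map Form.box, [A]⟩ ⟨Γ.map Form.box ++ Γ', Form.box A :: Δ'⟩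
  /-- Another listing of the same two multisets; this is not an inference of the calculus. -/
  | exch {Γ Γ' Δ Δ' : List Form} (e : Exch Γ Γ') (f : Exch Δ Δ') : Rule1 ⟨Γ, Δ⟩ ⟨Γ', Δ'⟩

/-- Rules with two premises; `Rule2 k S₁ S₂ S` has premises `S₁`, `S₂` and conclusion `S`. -/
inductive Rule2 : System → Sequent → Sequent → Sequent → Type
  /-- (→⊃): from `Γ ⊃ Δ, A` and `B, Γ ⊃ Δ` infer `A → B, Γ ⊃ Δ`. -/
  | impL (k : System) (A B : Form) (Γ Δ : List Form) :
      Rule2 k ⟨Γ, A :: Δ⟩ ⟨B :: Γ, Δ⟩ ⟨Form.imp A B :: Γ, Δ⟩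
  /-- (Cut): from `Γ ⊃ Δ, A` and `A, Γ ⊃ Δ` infer `Γ ⊃ Δ`. -/
  | cut (A : Form) (Γ Δ : List Form) :
      Rule2 System.cut ⟨Γ, A :: Δ⟩ ⟨A :: Γ, Δ⟩ ⟨Γ, Δ⟩
  /-- (□Cut): from `Γ ⊃ Δ, □A, □B` and `Γ ⊃ Δ, □(A → B), □B` infer `Γ ⊃ Δ, □B`. -/
  | boxCut (A B : Form) (Γ Δ : List Form) :
      Rule2 System.boxCut
        ⟨Γ, Form.box A :: Form.box B :: Δ⟩
        ⟨Γ, Form.box (Form.imp A B) :: Form.box B :: Δ⟩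
        ⟨Γ, Form.box B :: Δ⟩

/-- Proof trees of the system `k` with a given root sequent. -/
inductive Proof (k : System) : Sequent → Type
  | nullary {S : Sequent} (r : Rule0 S) : Proof k S
  | unary {S₁ S : Sequent} (r : Rule1 S₁ S) (d : Proof k S₁) : Proof k S
  | binary {S₁ S₂ S : Sequent} (r : Rule2 k S₁ S₂ S) (d₁ : Proof k S₁) (d₂ : Proof k S₂) :
      Proof k S

/-! ### Correspondence -/

/-- Direct correspondence for a rule with one premise: every occurrence of `□` in the premise
directly corresponds to one occurrence in the conclusion. -/
def Rule1.corr : {S₁ S : Sequent} → Rule1 S₁ S → SeqOcc S₁ → SeqOcc S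
  | _, _, Rule1.impR _ _ _ _, SeqOcc.ant (ListOcc.head o) =>
      SeqOcc.suc (ListOcc.head (BoxOcc.inLeft o))
  | _, _, Rule1.impR _ _ _ _, SeqOcc.ant (ListOcc.tail o) => SeqOcc.ant o
  | _, _, Rule1.impR _ _ _ _, SeqOcc.suc (ListOcc.head o) =>
      SeqOcc.suc (ListOcc.head (BoxOcc.inRight o))
  | _, _, Rule1.impR _ _ _ _, SeqOcc.suc (ListOcc.tail o) => SeqOcc.suc (ListOcc.tail o)
  | _, _, Rule1.boxL _ _ _, SeqOcc.ant (ListOcc.head o) =>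
      SeqOcc.ant (ListOcc.head (BoxOcc.inBox o))
  | _, _, Rule1.boxL _ _ _, SeqOcc.ant (ListOcc.tail o) => SeqOcc.ant o
  | _, _, Rule1.boxL _ _ _, SeqOcc.suc o => SeqOcc.suc o
  | _, _, Rule1.boxR _ _ Γ' _, SeqOcc.ant o => SeqOcc.ant (o.append Γ')
  | _, _, Rule1.boxR _ _ _ _, SeqOcc.suc (ListOcc.head o) =>
      SeqOcc.suc (ListOcc.head (BoxOcc.inBox o))
  | _, _, Rule1.exch e _, SeqOcc.ant o => SeqOcc.ant (e.map o)
  | _, _, Rule1.exch _ f, SeqOcc.suc o => SeqOcc.suc (f.map o)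

/-- The occurrences of `□` in the premises and the conclusion of a rule with two premises. -/
inductive RuleOcc (S₁ S₂ S : Sequent) : Type
  | left : SeqOcc S₁ → RuleOcc S₁ S₂ S
  | right : SeqOcc S₂ → RuleOcc S₁ S₂ S
  | concl : SeqOcc S → RuleOcc S₁ S₂ S

/-- Direct correspondence for a rule with two premises. -/
inductive Rule2.Corr : {k : System} → {S₁ S₂ S : Sequent} → Rule2 k S₁ S₂ S →
    RuleOcc S₁ S₂ S → RuleOcc S₁ S₂ S → Prop
  -- (→⊃), left premise `Γ ⊃ Δ, A`
  | impL_left_ant (k A B Γ Δ) (o : ListOcc Γ) :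
      Corr (Rule2.impL k A B Γ Δ) (RuleOcc.left (SeqOcc.ant o))
        (RuleOcc.concl (SeqOcc.ant (ListOcc.tail o)))
  | impL_left_suc (k A B Γ Δ) (o : ListOcc Δ) :
      Corr (Rule2.impL k A B Γ Δ) (RuleOcc.left (SeqOcc.suc (ListOcc.tail o)))
        (RuleOcc.concl (SeqOcc.suc o))
  | impL_left_active (k A B Γ Δ) (o : BoxOcc A) :
      Corr (Rule2.impL k A B Γ Δ) (RuleOcc.left (SeqOcc.suc (ListOcc.head o)))
        (RuleOcc.concl (SeqOcc.ant (ListOcc.head (BoxOcc.inLeft o))))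
  -- (→⊃), right premise `B, Γ ⊃ Δ`
  | impL_right_ant (k A B Γ Δ) (o : ListOcc Γ) :
      Corr (Rule2.impL k A B Γ Δ) (RuleOcc.right (SeqOcc.ant (ListOcc.tail o)))
        (RuleOcc.concl (SeqOcc.ant (ListOcc.tail o)))
  | impL_right_suc (k A B Γ Δ) (o : ListOcc Δ) :
      Corr (Rule2.impL k A B Γ Δ) (RuleOcc.right (SeqOcc.suc o))
        (RuleOcc.concl (SeqOcc.suc o))
  | impL_right_active (k A B Γ Δ) (o : BoxOcc B) :
      Corr (Rule2.impL k A B Γ Δ) (RuleOcc.right (SeqOcc.ant (ListOcc.head o)))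
        (RuleOcc.concl (SeqOcc.ant (ListOcc.head (BoxOcc.inRight o))))
  -- (Cut): side formulas
  | cut_left_ant (A Γ Δ) (o : ListOcc Γ) :
      Corr (Rule2.cut A Γ Δ) (RuleOcc.left (SeqOcc.ant o)) (RuleOcc.concl (SeqOcc.ant o))
  | cut_left_suc (A Γ Δ) (o : ListOcc Δ) :
      Corr (Rule2.cut A Γ Δ) (RuleOcc.left (SeqOcc.suc (ListOcc.tail o)))
        (RuleOcc.concl (SeqOcc.suc o))
  | cut_right_ant (A Γ Δ) (o : ListOcc Γ) :
      Corr (Rule2.cut A Γ Δ) (RuleOcc.right (SeqOcc.ant (ListOcc.tail o)))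
        (RuleOcc.concl (SeqOcc.ant o))
  | cut_right_suc (A Γ Δ) (o : ListOcc Δ) :
      Corr (Rule2.cut A Γ Δ) (RuleOcc.right (SeqOcc.suc o)) (RuleOcc.concl (SeqOcc.suc o))
  -- (Cut): the two copies of the cut formula
  | cut_active (A Γ Δ) (o : BoxOcc A) :
      Corr (Rule2.cut A Γ Δ) (RuleOcc.left (SeqOcc.suc (ListOcc.head o)))
        (RuleOcc.right (SeqOcc.ant (ListOcc.head o)))
  -- (□Cut): side formulas, and `□B` in the premises with `□B` in the conclusion
  | boxCut_left_ant (A B Γ Δ) (o : ListOcc Γ) :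
      Corr (Rule2.boxCut A B Γ Δ) (RuleOcc.left (SeqOcc.ant o)) (RuleOcc.concl (SeqOcc.ant o))
  | boxCut_left_suc (A B Γ Δ) (o : ListOcc (Form.box B :: Δ)) :
      Corr (Rule2.boxCut A B Γ Δ) (RuleOcc.left (SeqOcc.suc (ListOcc.tail o)))
        (RuleOcc.concl (SeqOcc.suc o))
  | boxCut_right_ant (A B Γ Δ) (o : ListOcc Γ) :
      Corr (Rule2.boxCut A B Γ Δ) (RuleOcc.right (SeqOcc.ant o)) (RuleOcc.concl (SeqOcc.ant o))
  | boxCut_right_suc (A B Γ Δ) (o : ListOcc (Form.box B :: Δ)) :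
      Corr (Rule2.boxCut A B Γ Δ) (RuleOcc.right (SeqOcc.suc (ListOcc.tail o)))
        (RuleOcc.concl (SeqOcc.suc o))
  -- (□Cut): the topmost `□` of `□A` and of `□(A → B)` with the topmost `□` of `□B`
  | boxCut_left_top (A B Γ Δ) :
      Corr (Rule2.boxCut A B Γ Δ) (RuleOcc.left (SeqOcc.suc (ListOcc.head BoxOcc.top)))
        (RuleOcc.concl (SeqOcc.suc (ListOcc.head BoxOcc.top)))
  | boxCut_right_top (A B Γ Δ) :
      Corr (Rule2.boxCut A B Γ Δ) (RuleOcc.right (SeqOcc.suc (ListOcc.head BoxOcc.top)))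
        (RuleOcc.concl (SeqOcc.suc (ListOcc.head BoxOcc.top)))
  -- (□Cut): the subformula `A` of `□A` with `A` in `□(A → B)`
  | boxCut_sub_left (A B Γ Δ) (o : BoxOcc A) :
      Corr (Rule2.boxCut A B Γ Δ)
        (RuleOcc.left (SeqOcc.suc (ListOcc.head (BoxOcc.inBox o))))
        (RuleOcc.right (SeqOcc.suc (ListOcc.head (BoxOcc.inBox (BoxOcc.inLeft o)))))
  -- (□Cut): the subformula `B` of `□(A → B)` with `B` in `□B`
  | boxCut_sub_right (A B Γ Δ) (o : BoxOcc B) :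
      Corr (Rule2.boxCut A B Γ Δ)
        (RuleOcc.right (SeqOcc.suc (ListOcc.head (BoxOcc.inBox (BoxOcc.inRight o)))))
        (RuleOcc.concl (SeqOcc.suc (ListOcc.head (BoxOcc.inBox o))))

/-- The occurrences of `□` in a proof tree: those in its root sequent and those in the subtrees
above the root. -/
inductive Occ {k : System} : {S : Sequent} → Proof k S → Type
  | root {S : Sequent} {d : Proof k S} (o : SeqOcc S) : Occ d
  | up {S₁ S : Sequent} {r : Rule1 S₁ S} {d : Proof k S₁} (o : Occ d) : Occ (Proof.unary r d)
  | upLeft {S₁ S₂ S : Sequent} {r : Rule2 k S₁ S₂ S} {d₁ : Proof k S₁} {d₂ : Proof k S₂}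
      (o : Occ d₁) : Occ (Proof.binary r d₁ d₂)
  | upRight {S₁ S₂ S : Sequent} {r : Rule2 k S₁ S₂ S} {d₁ : Proof k S₁} {d₂ : Proof k S₂}
      (o : Occ d₂) : Occ (Proof.binary r d₁ d₂)

/-- An occurrence has positive polarity relative to the sequent of the proof it belongs to. -/
def Occ.Positive {k : System} : {S : Sequent} → {d : Proof k S} → Occ d → Prop
  | _, _, Occ.root o => o.Positive
  | _, _, Occ.up o => o.Positive
  | _, _, Occ.upLeft o => o.Positive
  | _, _, Occ.upRight o => o.Positive

/-- Occurrences in the premises or conclusion of the last rule, as occurrences in the proof. -/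
def RuleOcc.toOcc {k : System} {S₁ S₂ S : Sequent} {r : Rule2 k S₁ S₂ S} {d₁ : Proof k S₁}
    {d₂ : Proof k S₂} : RuleOcc S₁ S₂ S → Occ (Proof.binary r d₁ d₂)
  | RuleOcc.left o => Occ.upLeft (Occ.root o)
  | RuleOcc.right o => Occ.upRight (Occ.root o)
  | RuleOcc.concl o => Occ.root o

/-- Direct correspondence of occurrences of `□` in a proof: by some rule of the proof. -/
inductive DirectCorr {k : System} : {S : Sequent} → {d : Proof k S} → Occ d → Occ d → Prop
  | unary {S₁ S : Sequent} (r : Rule1 S₁ S) (d : Proof k S₁) (o : SeqOcc S₁) :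
      DirectCorr (d := Proof.unary r d) (Occ.up (Occ.root o)) (Occ.root (r.corr o))
  | binary {S₁ S₂ S : Sequent} (r : Rule2 k S₁ S₂ S) (d₁ : Proof k S₁) (d₂ : Proof k S₂)
      (o o' : RuleOcc S₁ S₂ S) (h : r.Corr o o') :
      DirectCorr (d := Proof.binary r d₁ d₂) o.toOcc o'.toOcc
  | up {S₁ S : Sequent} (r : Rule1 S₁ S) {d : Proof k S₁} {o o' : Occ d} (h : DirectCorr o o') :
      DirectCorr (d := Proof.unary r d) (Occ.up o) (Occ.up o')
  | upLeft {S₁ S₂ S : Sequent} (r : Rule2 k S₁ S₂ S) {d₁ : Proof k S₁} (d₂ : Proof k S₂)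
      {o o' : Occ d₁} (h : DirectCorr o o') :
      DirectCorr (d := Proof.binary r d₁ d₂) (Occ.upLeft o) (Occ.upLeft o')
  | upRight {S₁ S₂ S : Sequent} (r : Rule2 k S₁ S₂ S) (d₁ : Proof k S₁) {d₂ : Proof k S₂}
      {o o' : Occ d₂} (h : DirectCorr o o') :
      DirectCorr (d := Proof.binary r d₁ d₂) (Occ.upRight o) (Occ.upRight o')

/-- A family of a proof: an equivalence class of occurrences of `□` under correspondence, the
equivalence relation generated by direct correspondence. -/
def Family {k : System} {S : Sequent} (d : Proof k S) : Type :=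
  Quot (DirectCorr (d := d))

/-- The family of an occurrence. -/
def Occ.family {k : System} {S : Sequent} {d : Proof k S} (o : Occ d) : Family d :=
  Quot.mk _ o

/-! ### Prehistoric relations -/

/-- `Introduced o`: the proof has a rule (⊃□) that introduces the occurrence `o`, that is, `o` is
the topmost `□` of the principal formula in the conclusion of that rule. -/
inductive Introduced {k : System} : {S : Sequent} → {d : Proof k S} → Occ d → Prop
  | boxR (A : Form) (Γ Γ' Δ' : List Form) (d : Proof k ⟨Γ.map Form.box, [A]⟩) :
      Introduced (d := Proof.unary (Rule1.boxR A Γ Γ' Δ') d)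
        (Occ.root (SeqOcc.suc (ListOcc.head BoxOcc.top)))
  | up {S₁ S : Sequent} (r : Rule1 S₁ S) {d : Proof k S₁} {o : Occ d} (h : Introduced o) :
      Introduced (d := Proof.unary r d) (Occ.up o)
  | upLeft {S₁ S₂ S : Sequent} (r : Rule2 k S₁ S₂ S) {d₁ : Proof k S₁} (d₂ : Proof k S₂)
      {o : Occ d₁} (h : Introduced o) :
      Introduced (d := Proof.binary r d₁ d₂) (Occ.upLeft o)
  | upRight {S₁ S₂ S : Sequent} (r : Rule2 k S₁ S₂ S) (d₁ : Proof k S₁) {d₂ : Proof k S₂}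
      {o : Occ d₂} (h : Introduced o) :
      Introduced (d := Proof.binary r d₁ d₂) (Occ.upRight o)

/-- `PremiseOcc o o'`: the proof has a rule (⊃□) that introduces the occurrence `o'`, and `o` is an
occurrence of `□`, on the left or on the right, in the premise of that rule. -/
inductive PremiseOcc {k : System} : {S : Sequent} → {d : Proof k S} → Occ d → Occ d → Prop
  | boxR (A : Form) (Γ Γ' Δ' : List Form) (d : Proof k ⟨Γ.map Form.box, [A]⟩)
      (o : SeqOcc ⟨Γ.map Form.box, [A]⟩) :
      PremiseOcc (d := Proof.unary (Rule1.boxR A Γ Γ' Δ') d)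
        (Occ.up (Occ.root o)) (Occ.root (SeqOcc.suc (ListOcc.head BoxOcc.top)))
  | up {S₁ S : Sequent} (r : Rule1 S₁ S) {d : Proof k S₁} {o o' : Occ d} (h : PremiseOcc o o') :
      PremiseOcc (d := Proof.unary r d) (Occ.up o) (Occ.up o')
  | upLeft {S₁ S₂ S : Sequent} (r : Rule2 k S₁ S₂ S) {d₁ : Proof k S₁} (d₂ : Proof k S₂)
      {o o' : Occ d₁} (h : PremiseOcc o o') :
      PremiseOcc (d := Proof.binary r d₁ d₂) (Occ.upLeft o) (Occ.upLeft o')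
  | upRight {S₁ S₂ S : Sequent} (r : Rule2 k S₁ S₂ S) (d₁ : Proof k S₁) {d₂ : Proof k S₂}
      {o o' : Occ d₂} (h : PremiseOcc o o') :
      PremiseOcc (d := Proof.binary r d₁ d₂) (Occ.upRight o) (Occ.upRight o')

/-- The prehistoric relation `i ≺ j` on all families of a proof: some rule (⊃□) introduces an
occurrence of the family `j`, and an occurrence of the family `i` is in its premise. -/
def Prehistoric {k : System} {S : Sequent} (d : Proof k S) (i j : Family d) : Prop :=
  ∃ o o' : Occ d, o.family = i ∧ o'.family = j ∧ PremiseOcc o o'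

/-- The proof has no prehistoric cycle `i₀ ≺ i₁ ≺ ⋯ ≺ iₙ₋₁ ≺ i₀`, for the prehistoric relation on
all families. -/
def CycleFree {k : System} {S : Sequent} (d : Proof k S) : Prop :=
  ¬ ∃ i : Family d, Relation.TransGen (Prehistoric d) i i

/-- The cycle-free fragment of a system: all sequents, as pairs of multisets of formulas, that have
a prehistoric-cycle-free proof in the system. -/
def cycleFreeFragment (k : System) : Set (Multiset Form × Multiset Form) :=
  {s | ∃ Γ Δ : List Form, ((Γ : Multiset Form), (Δ : Multiset Form)) = s ∧
    ∃ d : Proof k ⟨Γ, Δ⟩, CycleFree d}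

/-! ### The original notions for cut-free proofs -/

/-- Principal positive families: families of positive occurrences, at least one of which is
introduced by a rule (⊃□). -/
def PrincipalPositive {S : Sequent} (d : Proof System.g3s S) (i : Family d) : Prop :=
  (∀ o : Occ d, o.family = i → o.Positive) ∧ ∃ o : Occ d, o.family = i ∧ Introduced o

/-- The original prehistoric relation of a G3s-proof: that on principal positive families only. -/
def PrincipalPrehistoric {S : Sequent} (d : Proof System.g3s S) (i j : Family d) : Prop :=
  PrincipalPositive d i ∧ PrincipalPositive d j ∧ Prehistoric d i j

/-- The G3s-proof has no prehistoric cycle of principal positive families. -/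
def PrincipalCycleFree {S : Sequent} (d : Proof System.g3s S) : Prop :=
  ¬ ∃ i : Family d, Relation.TransGen (PrincipalPrehistoric d) i i

/-- The cycle-free fragment of G3s for the original prehistoric relation. -/
def principalCycleFreeFragment : Set (Multiset Form × Multiset Form) :=
  {s | ∃ Γ Δ : List Form, ((Γ : Multiset Form), (Δ : Multiset Form)) = s ∧
    ∃ d : Proof System.g3s ⟨Γ, Δ⟩, PrincipalCycleFree d}

end G3s

/-! Take the families of a cycle-free proof as labels on its boxes. The transitive closure `r` of
`≺` is then a strict order on labels, and cycle-freeness becomes a local condition on (⊃□): every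
label in the premise lies `r`-below the label of the introduced box. Corresponding occurrences carry
equal labels, so the two copies of a cut formula are one and the same labelled formula, and
occurrences need no further tracking.

Cut elimination respects the condition (`LDer.cut`). The critical case is a cut on `□A` with label
`n`, introduced from boxes below `n`, whose other copy stands in the premise of a (⊃□) with label
`m`. There `n` is below `m`, so by transitivity those boxes may replace `□A`. For (□Cut)
(`LDer.boxCut`), ordinary cuts with `□A, □(A → B) ⊃ □B` are no help: all three boxes share a label,
which would have to lie below itself. Instead the premises `Γ₁ ⊃ A` and `Γ₂ ⊃ A → B` of the two
introductions are merged into `Γ₁, Γ₂ ⊃ B`, whose context is still below the common label.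

The cut-free labelled derivation is turned into one with the exact rules of G3s (`LDer.strict`) and
then into a proof tree of any of the systems, whose occurrences inherit the labels
(`SDer.realizable`). Its families map to labels so that `≺` goes into `r`; irreflexivity of `r`
excludes cycles.

For the last claim, polarity is constant on families of a G3s-proof and introduced boxes are
positive, so every family on a prehistoric cycle is principal positive. -/

namespace G3s

/-! ### Labelled formulas -/

/-- Formulas whose boxes carry labels from `L`. -/
inductive LForm (L : Type) : Type
  | bot : LForm L
  | atom : ℕ → LForm L
  | imp : LForm L → LForm L → LForm L
  | box : L → LForm L → LForm L

variable {L : Type}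

/-- All labels in the formula are `r`-below `n`. -/
def LForm.Below (r : L → L → Prop) (n : L) : LForm L → Prop
  | .bot => True
  | .atom _ => True
  | .imp A B => A.Below r n ∧ B.Below r n
  | .box m A => r m n ∧ A.Below r n

/-- The formula is a box, and all its labels are `r`-below `n`. -/
def LForm.BoxBelow (r : L → L → Prop) (n : L) (C : LForm L) : Prop :=
  (∃ m A, C = .box m A) ∧ C.Below r n

theorem LForm.Below.trans {r : L → L → Prop} [IsTrans L r] {m n : L} (h : r m n) {A : LForm L}
    (hA : A.Below r m) : A.Below r n := by
  induction A with
  | bot => trivial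
  | atom => trivial
  | imp A B ihA ihB => exact ⟨ihA hA.1, ihB hA.2⟩
  | box k A ih => exact ⟨_root_.trans hA.1 h, ih hA.2⟩

/-- The labelled calculus with cumulative rules: principal formulas are repeated in premises. -/
inductive LDer (r : L → L → Prop) : List (LForm L) → List (LForm L) → Prop
  | ax {P : ℕ} {Γ Δ : List (LForm L)} : .atom P ∈ Γ → .atom P ∈ Δ → LDer r Γ Δ
  | botL {Γ Δ : List (LForm L)} : .bot ∈ Γ → LDer r Γ Δ
  | impL {A B : LForm L} {Γ Δ : List (LForm L)} :
      .imp A B ∈ Γ → LDer r Γ (A :: Δ) → LDer r (B :: Γ) Δ → LDer r Γ Δ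
  | impR {A B : LForm L} {Γ Δ : List (LForm L)} :
      .imp A B ∈ Δ → LDer r (A :: Γ) (B :: Δ) → LDer r Γ Δ
  | boxL {n : L} {A : LForm L} {Γ Δ : List (LForm L)} :
      .box n A ∈ Γ → LDer r (A :: Γ) Δ → LDer r Γ Δ
  | boxR {n : L} {A : LForm L} {Γ₀ Γ Δ : List (LForm L)} :
      .box n A ∈ Δ → Γ₀ ⊆ Γ → (∀ C ∈ Γ₀, C.BoxBelow r n) → A.Below r n → LDer r Γ₀ [A] →
      LDer r Γ Δ

/-! ### Structural rules, inversion and cut elimination in the labelled calculus -/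

namespace LDer

variable {r : L → L → Prop} {Γ Γ' Δ Δ' : List (LForm L)} {A B : LForm L} {n : L}

/-- Contexts act as sets: the rules only test membership, and (⊃□) has weakening built in.
Weakening, contraction and exchange are therefore one statement. -/
theorem mono (h : LDer r Γ Δ) (hΓ : Γ ⊆ Γ') (hΔ : Δ ⊆ Δ') : LDer r Γ' Δ' := by
  induction h generalizing Γ' Δ' with
  | ax h₁ h₂ => exact ax (hΓ h₁) (hΔ h₂)
  | botL h₁ => exact botL (hΓ h₁)
  | impL h₁ _ _ ih₁ ih₂ =>
    exact impL (hΓ h₁) (ih₁ hΓ (List.cons_subset_cons _ hΔ)) (ih₂ (List.cons_subset_cons _ hΓ) hΔ)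
  | impR h₁ _ ih =>
    exact impR (hΔ h₁) (ih (List.cons_subset_cons _ hΓ) (List.cons_subset_cons _ hΔ))
  | boxL h₁ _ ih => exact boxL (hΓ h₁) (ih (List.cons_subset_cons _ hΓ) hΔ)
  | boxR h₁ h₂ h₃ h₄ h₅ _ => exact boxR (hΔ h₁) (List.Subset.trans h₂ hΓ) h₃ h₄ h₅

/-- The hypothesis is an inclusion because the cumulative rules keep the implication in the
premises, possibly several times. Duplicates of `A` and `B` that arise are contracted by `mono`. -/
theorem impR_inv (h : LDer r Γ Δ') (hΔ : Δ' ⊆ .imp A B :: Δ) : LDer r (A :: Γ) (B :: Δ) := by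
  induction h generalizing Δ with
  | ax h₁ h₂ => exact ax (List.mem_cons_of_mem _ h₁) (by have := hΔ h₂; grind)
  | botL h₁ => exact botL (List.mem_cons_of_mem _ h₁)
  | @impL C D Γ _ h₁ _ _ ih₁ ih₂ =>
    exact impL (List.mem_cons_of_mem _ h₁)
      ((ih₁ (Δ := C :: Δ) (by grind)).mono (by grind) (by grind))
      ((ih₂ hΔ).mono (by grind) (by grind))
  | @impR C D Γ _ h₁ h₂ ih =>
    rcases List.mem_cons.1 (hΔ h₁) with h | h
    · cases h
      exact (ih (Δ := B :: Δ) (by grind)).mono (by grind) (by grind)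
    · exact impR (List.mem_cons_of_mem _ h)
        ((ih (Δ := D :: Δ) (by grind)).mono (by grind) (by grind))
  | boxL h₁ _ ih => exact boxL (List.mem_cons_of_mem _ h₁) ((ih hΔ).mono (by grind) (by grind))
  | boxR h₁ h₂ h₃ h₄ h₅ _ =>
    exact boxR (by have := hΔ h₁; grind) (by grind) h₃ h₄ h₅

theorem not_boxBelow_imp : ¬ (LForm.imp A B).BoxBelow r n := by
  rintro ⟨⟨m, C, h⟩, -⟩
  cases h

theorem impL_inv_left (h : LDer r Γ' Δ) (hΓ : Γ' ⊆ .imp A B :: Γ) : LDer r Γ (A :: Δ) := by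
  induction h generalizing Γ with
  | ax h₁ h₂ => exact ax (by have := hΓ h₁; grind) (List.mem_cons_of_mem _ h₂)
  | botL h₁ => exact botL (by have := hΓ h₁; grind)
  | @impL C D _ Δ h₁ _ _ ih₁ ih₂ =>
    rcases List.mem_cons.1 (hΓ h₁) with h | h
    · cases h
      exact (ih₁ hΓ).mono (by grind) (by grind)
    · exact impL h ((ih₁ hΓ).mono (by grind) (by grind)) (ih₂ (by grind))
  | @impR C D _ Δ h₁ _ ih =>
    exact impR (List.mem_cons_of_mem _ h₁) ((ih (Γ := C :: Γ) (by grind)).mono (by grind) (by grind))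
  | @boxL n C _ Δ h₁ _ ih =>
    exact boxL (n := n) (A := C) (by have := hΓ h₁; grind) (ih (Γ := C :: Γ) (by grind))
  | boxR h₁ h₂ h₃ h₄ h₅ _ =>
    -- The context `Γ₀` consists of boxes, so the implication is not among them and the premise
    -- stays as it is.
    refine boxR (List.mem_cons_of_mem _ h₁) (fun C hC => ?_) h₃ h₄ h₅
    rcases List.mem_cons.1 (hΓ (h₂ hC)) with h | h
    · exact (not_boxBelow_imp (h ▸ h₃ C hC)).elim
    · exact h

theorem impL_inv_right (h : LDer r Γ' Δ) (hΓ : Γ' ⊆ .imp A B :: Γ) : LDer r (B :: Γ) Δ := by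
  induction h generalizing Γ with
  | ax h₁ h₂ => exact ax (by have := hΓ h₁; grind) h₂
  | botL h₁ => exact botL (by have := hΓ h₁; grind)
  | @impL C D _ Δ h₁ _ _ ih₁ ih₂ =>
    rcases List.mem_cons.1 (hΓ h₁) with h | h
    · cases h
      exact (ih₂ (Γ := B :: Γ) (by grind)).mono (by grind) (by grind)
    · exact impL (List.mem_cons_of_mem _ h) (ih₁ hΓ)
        ((ih₂ (Γ := D :: Γ) (by grind)).mono (by grind) (by grind))
  | @impR C D _ Δ h₁ _ ih =>
    exact impR h₁ ((ih (Γ := C :: Γ) (by grind)).mono (by grind) (by grind))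
  | @boxL n C _ Δ h₁ _ ih =>
    exact boxL (n := n) (A := C) (by have := hΓ h₁; grind)
      ((ih (Γ := C :: Γ) (by grind)).mono (by grind) (by grind))
  | boxR h₁ h₂ h₃ h₄ h₅ _ =>
    refine boxR h₁ (fun C hC => ?_) h₃ h₄ h₅
    rcases List.mem_cons.1 (hΓ (h₂ hC)) with h | h
    · exact (not_boxBelow_imp (h ▸ h₃ C hC)).elim
    · exact List.mem_cons_of_mem _ h

/-- A formula `A` on the right can be removed if this is possible wherever `A` is the principal
formula of an axiom or of the rule (⊃□); `A` is not an implication. -/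
theorem remove_right (hA : ∀ C D, A ≠ .imp C D) (h : LDer r Γ Δ') (hΔ : Δ' ⊆ A :: Δ)
    (hax : ∀ P Γ' Δ', Γ ⊆ Γ' → Δ ⊆ Δ' → A = .atom P → .atom P ∈ Γ' → LDer r Γ' Δ')
    (hbox : ∀ n C Γ₀ Γ' Δ', Γ ⊆ Γ' → Δ ⊆ Δ' → A = .box n C → Γ₀ ⊆ Γ' →
      (∀ D ∈ Γ₀, D.BoxBelow r n) → C.Below r n → LDer r Γ₀ [C] → LDer r Γ' Δ') :
    LDer r Γ Δ := by
  induction h generalizing Δ with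
  | @ax P Γ _ h₁ h₂ =>
    rcases List.mem_cons.1 (hΔ h₂) with h | h
    · exact hax P Γ Δ (List.Subset.refl _) (List.Subset.refl _) h.symm h₁
    · exact ax h₁ h
  | botL h₁ => exact botL h₁
  | @impL C D Γ _ h₁ _ _ ih₁ ih₂ =>
    -- The two hypotheses speak of all larger contexts, so they survive the passage to premises.
    refine impL h₁ (ih₁ (by grind) ?_ ?_) (ih₂ hΔ ?_ ?_)
    · exact fun P Γ' Δ' hΓ' hΔ' => hax P Γ' Δ' hΓ' (List.cons_subset.1 hΔ').2
    · exact fun n E Γ₀ Γ' Δ' hΓ' hΔ' => hbox n E Γ₀ Γ' Δ' hΓ' (List.cons_subset.1 hΔ').2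
    · exact fun P Γ' Δ' hΓ' hΔ' => hax P Γ' Δ' (List.cons_subset.1 hΓ').2 hΔ'
    · exact fun n E Γ₀ Γ' Δ' hΓ' hΔ' => hbox n E Γ₀ Γ' Δ' (List.cons_subset.1 hΓ').2 hΔ'
  | @impR C D Γ _ h₁ _ ih =>
    rcases List.mem_cons.1 (hΔ h₁) with h | h
    · exact (hA _ _ h.symm).elim
    refine impR h (ih (by grind) ?_ ?_)
    · exact fun P Γ' Δ' hΓ' hΔ' =>
        hax P Γ' Δ' (List.cons_subset.1 hΓ').2 (List.cons_subset.1 hΔ').2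
    · exact fun n E Γ₀ Γ' Δ' hΓ' hΔ' =>
        hbox n E Γ₀ Γ' Δ' (List.cons_subset.1 hΓ').2 (List.cons_subset.1 hΔ').2
  | boxL h₁ _ ih =>
    refine boxL h₁ (ih hΔ ?_ ?_)
    · exact fun P Γ' Δ' hΓ' hΔ' => hax P Γ' Δ' (List.cons_subset.1 hΓ').2 hΔ'
    · exact fun n E Γ₀ Γ' Δ' hΓ' hΔ' => hbox n E Γ₀ Γ' Δ' (List.cons_subset.1 hΓ').2 hΔ'
  | @boxR n C Γ₀ Γ _ h₁ h₂ h₃ h₄ h₅ _ =>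
    rcases List.mem_cons.1 (hΔ h₁) with h | h
    · exact hbox n C Γ₀ Γ Δ (List.Subset.refl _) (List.Subset.refl _) h.symm h₂ h₃ h₄ h₅
    · exact boxR h h₂ h₃ h₄ h₅

/-- A boxed formula on the left can be removed if it follows by (⊃□) from boxed formulas `Γ₀` that
are present, provided cuts with the unboxed formula are admissible. -/
theorem remove_box_left [IsTrans L r] {Γ₀ : List (LForm L)}
    (hcut : ∀ Γ Δ, LDer r Γ (A :: Δ) → LDer r (A :: Γ) Δ → LDer r Γ Δ)
    (h₀ : ∀ C ∈ Γ₀, C.BoxBelow r n) (hd : LDer r Γ₀ [A])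
    (h : LDer r Γ' Δ) (hΓ : Γ' ⊆ .box n A :: Γ) (hΓ₀ : Γ₀ ⊆ Γ) : LDer r Γ Δ := by
  classical
  induction h generalizing Γ with
  | ax h₁ h₂ => exact ax (by have := hΓ h₁; grind) h₂
  | botL h₁ => exact botL (by have := hΓ h₁; grind)
  | @impL C D Γ' Δ h₁ _ _ ih₁ ih₂ =>
    exact impL (A := C) (B := D) ((List.mem_cons.1 (hΓ h₁)).resolve_left (by simp)) (ih₁ hΓ hΓ₀)
      (ih₂ (by clear hcut; grind) (List.subset_cons_of_subset _ hΓ₀))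
  | @impR C D Γ' Δ h₁ _ ih =>
    exact impR h₁ (ih (by clear hcut; grind) (List.subset_cons_of_subset _ hΓ₀))
  | @boxL m C Γ' Δ h₁ _ ih =>
    have h := ih (Γ := C :: Γ) (by grind) (by grind)
    rcases List.mem_cons.1 (hΓ h₁) with h' | h'
    · cases h'
      -- Here `□A` itself is unboxed: the derivation of `A` from `Γ₀` is cut against the premise.
      exact hcut _ _ (hd.mono hΓ₀ (by grind)) h
    · exact boxL h' h
  | @boxR m C Γ₁ Γ' Δ h₁ h₂ h₃ h₄ h₅ ih =>
    by_cases hm : LForm.box n A ∈ Γ₁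
    · have hnm : r n m := (h₃ _ hm).2.1
      refine boxR (Γ₀ := Γ₁.filter (· ≠ .box n A) ++ Γ₀) h₁ (by grind) (fun D hD => ?_) h₄
        (ih (by grind) (by grind))
      rcases List.mem_append.1 hD with hD | hD
      · exact h₃ D (List.mem_filter.1 hD).1
      · exact ⟨(h₀ D hD).1, (h₀ D hD).2.trans hnm⟩
    · exact boxR h₁ (fun D hD => (List.mem_cons.1 (hΓ (h₂ hD))).resolve_left
        fun e => hm (e ▸ hD)) h₃ h₄ h₅

/-- Induction on the cut formula alone: the inductions on derivations are in the inversion and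
removal lemmas. For a box, the left derivation is followed up to the rules introducing it, and there
the box is removed from the right derivation. -/
theorem cut [IsTrans L r] (h₁ : LDer r Γ (A :: Δ)) (h₂ : LDer r (A :: Γ) Δ) : LDer r Γ Δ := by
  induction A generalizing Γ Δ with
  | bot =>
    exact remove_right (by simp) h₁ (List.Subset.refl _) (by simp) (by simp)
  | atom P =>
    refine remove_right (by simp) h₁ (List.Subset.refl _) ?_ (by simp)
    rintro Q Γ' Δ' hΓ hΔ h hQ
    cases h
    exact h₂.mono (by grind) hΔ
  | imp A B ihA ihB =>
    have h₃ := h₁.impR_inv (List.Subset.refl _)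
    have h₄ := h₂.impL_inv_left (List.Subset.refl _)
    have h₅ := h₂.impL_inv_right (List.Subset.refl _)
    exact ihA h₄ (ihB h₃ (h₅.mono (by grind) (by grind)))
  | box n A ih =>
    refine remove_right (by simp) h₁ (List.Subset.refl _) (by simp) ?_
    rintro m C Γ₀ Γ' Δ' hΓ hΔ h hΓ₀ h₃ - h₅
    cases h
    exact remove_box_left (fun _ _ => ih) h₃ h₅ (h₂.mono (List.cons_subset_cons _ hΓ) hΔ)
      (List.Subset.refl _) hΓ₀

/-- Both boxes are followed up to their introductions, from `Γ₁` and from `Γ₂`, and there `□B` is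
introduced directly. The side condition holds because all three boxes have the label `n` and `B` is
part of `A → B`. -/
theorem boxCut [IsTrans L r] (h₁ : LDer r Γ (.box n A :: .box n B :: Δ))
    (h₂ : LDer r Γ (.box n (.imp A B) :: .box n B :: Δ)) : LDer r Γ (.box n B :: Δ) := by
  refine remove_right (by simp) h₁ (List.Subset.refl _) (by simp) ?_
  rintro m C Γ₁ Γ' Δ' hΓ hΔ h hΓ₁ h₃ - h₄
  cases h
  refine remove_right (by simp) (h₂.mono hΓ (List.cons_subset_cons _ hΔ)) (List.Subset.refl _)
    (by simp) ?_
  rintro m C Γ₂ Γ'' Δ'' hΓ' hΔ' h hΓ₂ h₅ h₆ h₇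
  cases h
  refine boxR (Γ₀ := Γ₁ ++ Γ₂) (hΔ' (hΔ List.mem_cons_self)) (by grind) (by grind) h₆.2 ?_
  exact cut (A := A) (h₄.mono (by grind) (by grind))
    ((h₇.impR_inv (List.Subset.refl _)).mono (by grind) (by grind))

end LDer

/-! ### The strict labelled calculus -/

/-- The labelled calculus with the rules of G3s. -/
inductive SDer (r : L → L → Prop) : List (LForm L) → List (LForm L) → Prop
  | ax (P : ℕ) (Γ Δ : List (LForm L)) : SDer r (.atom P :: Γ) (.atom P :: Δ)
  | botL (Γ Δ : List (LForm L)) : SDer r (.bot :: Γ) Δ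
  | impL {A B : LForm L} {Γ Δ : List (LForm L)} :
      SDer r Γ (A :: Δ) → SDer r (B :: Γ) Δ → SDer r (.imp A B :: Γ) Δ
  | impR {A B : LForm L} {Γ Δ : List (LForm L)} :
      SDer r (A :: Γ) (B :: Δ) → SDer r Γ (.imp A B :: Δ)
  | boxL {n : L} {A : LForm L} {Γ Δ : List (LForm L)} :
      SDer r (A :: .box n A :: Γ) Δ → SDer r (.box n A :: Γ) Δ
  | boxR {n : L} {A : LForm L} {Γ₀ : List (LForm L)} (Γ' Δ' : List (LForm L)) :
      (∀ C ∈ Γ₀, C.BoxBelow r n) → A.Below r n → SDer r Γ₀ [A] →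
      SDer r (Γ₀ ++ Γ') (.box n A :: Δ')
  | perm {Γ Γ' Δ Δ' : List (LForm L)} : Γ.Perm Γ' → Δ.Perm Δ' → SDer r Γ Δ → SDer r Γ' Δ'

/-- `Covered Γ Δ b A`: the formula `A`, on the left (`b = false`) or on the right (`b = true`),
stands in the sequent `Γ ⊃ Δ` or has been decomposed there. -/
inductive Covered (Γ Δ : List (LForm L)) : Bool → LForm L → Prop
  | left {A : LForm L} : A ∈ Γ → Covered Γ Δ false A
  | right {A : LForm L} : A ∈ Δ → Covered Γ Δ true A
  | impL_left {A B : LForm L} : Covered Γ Δ true A → Covered Γ Δ false (.imp A B)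
  | impL_right {A B : LForm L} : Covered Γ Δ false B → Covered Γ Δ false (.imp A B)
  | impR {A B : LForm L} : Covered Γ Δ false A → Covered Γ Δ true B → Covered Γ Δ true (.imp A B)

theorem Covered.trans {Γ Δ Γ' Δ' : List (LForm L)} {b : Bool} {A : LForm L}
    (h : Covered Γ Δ b A) (hΓ : ∀ C ∈ Γ, Covered Γ' Δ' false C)
    (hΔ : ∀ C ∈ Δ, Covered Γ' Δ' true C) : Covered Γ' Δ' b A := by
  induction h with
  | left h => exact hΓ _ h
  | right h => exact hΔ _ h
  | impL_left _ ih => exact .impL_left ih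
  | impL_right _ ih => exact .impL_right ih
  | impR _ _ ih₁ ih₂ => exact .impR ih₁ ih₂

theorem SDer.of_mem_left {r : L → L → Prop} {Γ Δ : List (LForm L)} {A : LForm L} (hA : A ∈ Γ)
    (h : ∀ Γ', Γ.Perm (A :: Γ') → SDer r (A :: Γ') Δ) : SDer r Γ Δ := by
  obtain ⟨s, t, rfl⟩ := List.append_of_mem hA
  exact .perm List.perm_middle.symm (.refl _) (h _ List.perm_middle)

theorem SDer.of_mem_right {r : L → L → Prop} {Γ Δ : List (LForm L)} {A : LForm L} (hA : A ∈ Δ)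
    (h : ∀ Δ', Δ.Perm (A :: Δ') → SDer r Γ (A :: Δ')) : SDer r Γ Δ := by
  obtain ⟨s, t, rfl⟩ := List.append_of_mem hA
  exact .perm (.refl _) List.perm_middle.symm (h _ List.perm_middle)

/-- `Covered` makes up for principal formulas that the strict rules discard. If a principal formula
is still present, the strict rule is applied; if it was decomposed earlier, a suitable premise is
already covered and no inference is made. Atoms, `⊥` and boxes are never decomposed. -/
theorem LDer.strict {r : L → L → Prop} {Γ Δ Γ' Δ' : List (LForm L)} (h : LDer r Γ Δ)
    (hΓ : ∀ C ∈ Γ, Covered Γ' Δ' false C) (hΔ : ∀ C ∈ Δ, Covered Γ' Δ' true C) :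
    SDer r Γ' Δ' := by
  classical
  induction h generalizing Γ' Δ' with
  | ax h₁ h₂ =>
    cases hΓ _ h₁ with
    | left h₁ =>
    cases hΔ _ h₂ with
    | right h₂ =>
    exact .of_mem_left h₁ fun _ _ => .of_mem_right h₂ fun _ _ => .ax _ _ _
  | botL h₁ =>
    cases hΓ _ h₁ with
    | left h₁ => exact .of_mem_left h₁ fun _ _ => .botL _ _
  | @impL A B Γ Δ h₁ _ _ ih₁ ih₂ =>
    cases hΓ _ h₁ with
    | left h =>
      refine .of_mem_left h fun Γ₁ hp => .impL (ih₁ ?_ ?_) (ih₂ ?_ ?_)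
      all_goals
        have key₁ : ∀ C ∈ Γ', Covered Γ₁ (A :: Δ') false C := fun C hC => by
          rcases List.mem_cons.1 (hp.subset hC) with rfl | hC
          · exact .impL_left (.right List.mem_cons_self)
          · exact .left hC
        have key₂ : ∀ C ∈ Γ', Covered (B :: Γ₁) Δ' false C := fun C hC => by
          rcases List.mem_cons.1 (hp.subset hC) with rfl | hC
          · exact .impL_right (.left List.mem_cons_self)
          · exact .left (List.mem_cons_of_mem _ hC)
      · exact fun C hC => (hΓ C hC).trans key₁ fun D hD => .right (List.mem_cons_of_mem _ hD)
      · exact List.forall_mem_cons.2 ⟨.right List.mem_cons_self, fun C hC =>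
          (hΔ C hC).trans key₁ fun D hD => .right (List.mem_cons_of_mem _ hD)⟩
      · exact List.forall_mem_cons.2 ⟨.left List.mem_cons_self, fun C hC =>
          (hΓ C hC).trans key₂ fun D hD => .right hD⟩
      · exact fun C hC => (hΔ C hC).trans key₂ fun D hD => .right hD
    -- The implication was decomposed earlier, and the covered component selects the premise to
    -- follow.
    | impL_left h => exact ih₁ hΓ (List.forall_mem_cons.2 ⟨h, hΔ⟩)
    | impL_right h => exact ih₂ (List.forall_mem_cons.2 ⟨h, hΓ⟩) hΔ
  | @impR A B Γ Δ h₁ _ ih =>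
    cases hΔ _ h₁ with
    | right h =>
      refine .of_mem_right h fun Δ₁ hp => .impR (ih ?_ ?_)
      all_goals
        have key : ∀ C ∈ Δ', Covered (A :: Γ') (B :: Δ₁) true C := fun C hC => by
          rcases List.mem_cons.1 (hp.subset hC) with rfl | hC
          · exact .impR (.left List.mem_cons_self) (.right List.mem_cons_self)
          · exact .right (List.mem_cons_of_mem _ hC)
      · exact List.forall_mem_cons.2 ⟨.left List.mem_cons_self, fun C hC =>
          (hΓ C hC).trans (fun D hD => .left (List.mem_cons_of_mem _ hD)) key⟩
      · exact List.forall_mem_cons.2 ⟨.right List.mem_cons_self, fun C hC =>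
          (hΔ C hC).trans (fun D hD => .left (List.mem_cons_of_mem _ hD)) key⟩
    | impR h h' => exact ih (List.forall_mem_cons.2 ⟨h, hΓ⟩) (List.forall_mem_cons.2 ⟨h', hΔ⟩)
  | @boxL n A Γ Δ h₁ _ ih =>
    cases hΓ _ h₁ with
    | left h =>
      refine .of_mem_left h fun Γ₁ hp => .boxL (ih ?_ ?_)
      all_goals
        have key : ∀ C ∈ Γ', Covered (A :: .box n A :: Γ₁) Δ' false C := fun C hC =>
          .left (List.mem_cons_of_mem _ (hp.subset hC))
      · exact List.forall_mem_cons.2 ⟨.left List.mem_cons_self, fun C hC =>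
          (hΓ C hC).trans key fun D hD => .right hD⟩
      · exact fun C hC => (hΔ C hC).trans key fun D hD => .right hD
  | @boxR n A Γ₀ Γ Δ h₁ h₂ h₃ h₄ _ ih =>
    cases hΔ _ h₁ with
    | right h =>
      refine .of_mem_right h fun Δ₁ _ => ?_
      -- `Γ₀` is contained in `Γ'` only as a set. Without repetitions it is a submultiset, as the
      -- strict (⊃□) requires.
      have hsub : Γ₀.dedup.Subperm Γ' := by
        refine (List.nodup_dedup _).subperm fun C hC => ?_
        rw [List.mem_dedup] at hC
        obtain ⟨⟨m, D, rfl⟩, -⟩ := h₃ C hC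
        cases hΓ _ (h₂ hC) with
        | left h => exact h
      obtain ⟨Γ₁, hp⟩ : ∃ Γ₁, Γ'.Perm (Γ₀.dedup ++ Γ₁) :=
        ⟨_, (List.subperm_append_diff_self_of_count_le
          (List.subperm_ext_iff.1 hsub)).symm⟩
      refine .perm hp.symm (.refl _) (.boxR _ _ (fun C hC => h₃ C (List.mem_dedup.1 hC)) h₄
        (ih (fun C hC => .left (List.mem_dedup.2 hC)) fun C hC => .right hC))

/-! ### Labellings of occurrences -/

/-- The labelled formula obtained from a labelling of the occurrences of `□` in a formula. -/
def Form.label : (A : Form) → (BoxOcc A → L) → LForm L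
  | .bot, _ => .bot
  | .atom P, _ => .atom P
  | .imp A B, g => .imp (A.label fun o => g (.inLeft o)) (B.label fun o => g (.inRight o))
  | .box A, g => .box (g .top) (A.label fun o => g (.inBox o))

/-- The list of labelled formulas obtained from a labelling of the occurrences of `□` in a list. -/
def labelList : (l : List Form) → (ListOcc l → L) → List (LForm L)
  | [], _ => []
  | A :: l, g => A.label (fun o => g (.head o)) :: labelList l fun o => g (.tail o)

theorem Form.below_label {r : L → L → Prop} {n : L} {A : Form} {g : BoxOcc A → L} :
    (A.label g).Below r n ↔ ∀ o, r (g o) n := by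
  induction A with
  | bot => exact ⟨fun _ o => (nomatch o), fun _ => trivial⟩
  | atom => exact ⟨fun _ o => (nomatch o), fun _ => trivial⟩
  | imp A B ihA ihB =>
    refine ⟨fun h o => ?_, fun h => ⟨ihA.2 fun o => h _, ihB.2 fun o => h _⟩⟩
    cases o with
    | inLeft o => exact ihA.1 h.1 o
    | inRight o => exact ihB.1 h.2 o
  | box A ih =>
    refine ⟨fun h o => ?_, fun h => ⟨h _, ih.2 fun o => h _⟩⟩
    cases o with
    | top => exact h.1
    | inBox o => exact ih.1 h.2 o

theorem forall_below_labelList {r : L → L → Prop} {n : L} {l : List Form} {g : ListOcc l → L} :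
    (∀ C ∈ labelList l g, C.Below r n) ↔ ∀ o, r (g o) n := by
  induction l with
  | nil => exact ⟨fun _ o => (nomatch o), fun _ C hC => (by cases hC)⟩
  | cons A l ih =>
    rw [labelList, List.forall_mem_cons, Form.below_label, ih]
    refine ⟨fun h o => ?_, fun h => ⟨fun o => h _, fun o => h _⟩⟩
    cases o with
    | head o => exact h.1 o
    | tail o => exact h.2 o

theorem labelList_map_box {l : List Form} {g : ListOcc (l.map Form.box) → L} {C : LForm L}
    (hC : C ∈ labelList (l.map Form.box) g) : ∃ m A, C = .box m A := by
  induction l with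
  | nil => cases hC
  | cons A l ih =>
    rcases List.mem_cons.1 hC with rfl | hC
    · exact ⟨_, _, rfl⟩
    · exact ih hC

theorem labelList_append_subset {l l' : List Form} (g : ListOcc (l ++ l') → L) :
    labelList l (fun o => g (o.append l')) ⊆ labelList (l ++ l') g := by
  induction l with
  | nil => exact List.nil_subset _
  | cons A l ih => exact List.cons_subset_cons _ (ih fun o => g (.tail o))

theorem Exch.perm_labelList {l l' : List Form} (e : Exch l l') (g : ListOcc l' → L) :
    (labelList l fun o => g (e.map o)).Perm (labelList l' g) := by
  induction e with
  | nil => exact .refl _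
  | cons A e ih => exact .cons _ (ih fun o => g (.tail o))
  | swap A B l => exact .swap _ _ _
  | trans e e' ih ih' => exact (ih _).trans (ih' g)

/-! ### From proofs to labelled derivations -/

/-- A labelling of a proof is adequate if it is constant on families, and if labels increase
along the prehistoric relation. -/
structure Adequate {k : System} {S : Sequent} (r : L → L → Prop) (d : Proof k S) (f : Occ d → L) :
    Prop where
  corr : ∀ o o', DirectCorr o o' → f o = f o'
  prem : ∀ o o', PremiseOcc o o' → r (f o) (f o')

/-- Constancy on families lets the labels in premises be rewritten along correspondence until the
labelled formulas match those of the labelled rule. Monotonicity along `PremiseOcc` is the side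
condition of (⊃□), and the two cut rules are absorbed by their admissibility. -/
theorem Adequate.labelled {k : System} {r : L → L → Prop} [IsTrans L r] {S : Sequent}
    {d : Proof k S} {f : Occ d → L} (hf : Adequate r d f) :
    LDer r (labelList S.ant fun o => f (.root (.ant o)))
      (labelList S.suc fun o => f (.root (.suc o))) := by
  induction d with
  | nullary rl =>
    cases rl with
    | ax => exact .ax List.mem_cons_self List.mem_cons_self
    | botL => exact .botL List.mem_cons_self
  | unary rl d ih =>
    have h := ih (f := fun o => f (.up o)) ⟨fun o o' h => hf.corr _ _ (.up rl h),
      fun o o' h => hf.prem _ _ (.up rl h)⟩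
    have hc := fun o => hf.corr _ _ (.unary rl d o)
    cases rl with
    | impR A B Γ Δ =>
      simp only [labelList, Form.label, hc, Rule1.corr] at h ⊢
      exact .impR List.mem_cons_self (h.mono (List.Subset.refl _) (by grind))
    | boxL A Γ Δ =>
      simp only [labelList, Form.label, hc, Rule1.corr] at h ⊢
      exact .boxL List.mem_cons_self h
    | boxR A Γ Γ' Δ' =>
      have hp := fun o => hf.prem _ _ (.boxR A Γ Γ' Δ' d o)
      simp only [hc] at hp
      simp only [labelList, Form.label, hc, Rule1.corr] at h ⊢
      refine .boxR List.mem_cons_self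
        (labelList_append_subset (l := Γ.map Form.box) fun o => f (.root (.ant o)))
        (fun C hC => ⟨labelList_map_box hC, ?_⟩) ?_ h
      · exact forall_below_labelList.2 (fun o => hp (.ant o)) C hC
      · exact Form.below_label.2 fun o => hp (.suc (.head o))
    | exch e e' =>
      simp only [hc, Rule1.corr] at h
      exact h.mono (e.perm_labelList fun o => f (.root (.ant o))).subset
        (e'.perm_labelList fun o => f (.root (.suc o))).subset
  | binary rl d₁ d₂ ih₁ ih₂ =>
    have h₁ := ih₁ (f := fun o => f (.upLeft o)) ⟨fun o o' h => hf.corr _ _ (.upLeft rl d₂ h),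
      fun o o' h => hf.prem _ _ (.upLeft rl d₂ h)⟩
    have h₂ := ih₂ (f := fun o => f (.upRight o)) ⟨fun o o' h => hf.corr _ _ (.upRight rl d₁ h),
      fun o o' h => hf.prem _ _ (.upRight rl d₁ h)⟩
    have hc := fun o o' h => hf.corr _ _ (.binary rl d₁ d₂ o o' h)
    cases rl with
    | impL _ A B Γ Δ =>
      have c₁ := fun o => hc _ _ (.impL_left_ant k A B Γ Δ o)
      have c₂ := fun o => hc _ _ (.impL_left_suc k A B Γ Δ o)
      have c₃ := fun o => hc _ _ (.impL_left_active k A B Γ Δ o)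
      have c₄ := fun o => hc _ _ (.impL_right_ant k A B Γ Δ o)
      have c₅ := fun o => hc _ _ (.impL_right_suc k A B Γ Δ o)
      have c₆ := fun o => hc _ _ (.impL_right_active k A B Γ Δ o)
      simp only [RuleOcc.toOcc] at c₁ c₂ c₃ c₄ c₅ c₆
      simp only [labelList, Form.label, c₁, c₂, c₃, c₄, c₅, c₆] at h₁ h₂ ⊢
      exact .impL List.mem_cons_self (h₁.mono (List.subset_cons_self _ _) (List.Subset.refl _))
        (h₂.mono (List.cons_subset_cons _ (List.subset_cons_self _ _)) (List.Subset.refl _))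
    | cut A Γ Δ =>
      have c₁ := fun o => hc _ _ (.cut_left_ant A Γ Δ o)
      have c₂ := fun o => hc _ _ (.cut_left_suc A Γ Δ o)
      have c₃ := fun o => hc _ _ (.cut_right_ant A Γ Δ o)
      have c₄ := fun o => hc _ _ (.cut_right_suc A Γ Δ o)
      have c₅ := fun o => hc _ _ (.cut_active A Γ Δ o)
      simp only [RuleOcc.toOcc] at c₁ c₂ c₃ c₄ c₅
      simp only [labelList, c₁, c₂, c₃, c₄, c₅] at h₁ h₂ ⊢
      exact h₁.cut h₂
    | boxCut A B Γ Δ =>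
      have c₁ := fun o => hc _ _ (.boxCut_left_ant A B Γ Δ o)
      have c₂ := fun o => hc _ _ (.boxCut_left_suc A B Γ Δ o)
      have c₃ := fun o => hc _ _ (.boxCut_right_ant A B Γ Δ o)
      have c₄ := fun o => hc _ _ (.boxCut_right_suc A B Γ Δ o)
      have c₅ := hc _ _ (.boxCut_left_top A B Γ Δ)
      have c₆ := hc _ _ (.boxCut_right_top A B Γ Δ)
      have c₇ := fun o => hc _ _ (.boxCut_sub_left A B Γ Δ o)
      have c₈ := fun o => hc _ _ (.boxCut_sub_right A B Γ Δ o)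
      simp only [RuleOcc.toOcc] at c₁ c₂ c₃ c₄ c₅ c₆ c₇ c₈
      simp only [labelList, Form.label, c₁, c₂, c₃, c₄, c₅, c₆, c₇, c₈] at h₁ h₂ ⊢
      exact h₁.boxCut h₂

/-! ### From labelled derivations to proofs -/

theorem labelList_eq_append {l : List Form} {g : ListOcc l → L} {X Y : List (LForm L)}
    (h : labelList l g = X ++ Y) :
    ∃ l₁ l₂, ∃ e : l = l₁ ++ l₂, labelList l₁ (fun o => g (e ▸ o.append l₂)) = X := by
  induction X generalizing l with
  | nil => exact ⟨[], l, rfl, rfl⟩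
  | cons C X ih =>
    cases l with
    | nil => cases h
    | cons A l =>
      obtain ⟨h₁, h₂⟩ := List.cons_eq_cons.1 h
      obtain ⟨l₁, l₂, rfl, h₃⟩ := ih h₂
      exact ⟨A :: l₁, l₂, rfl, congrArg₂ List.cons h₁ h₃⟩

theorem exists_map_box {l : List Form} {g : ListOcc l → L}
    (h : ∀ C ∈ labelList l g, ∃ m A, C = .box m A) : ∃ l' : List Form, l = l'.map Form.box := by
  induction l with
  | nil => exact ⟨[], rfl⟩
  | cons A l ih =>
    obtain ⟨h₁, h₂⟩ := List.forall_mem_cons.1 h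
    obtain ⟨l', rfl⟩ := ih h₂
    obtain ⟨m, B, hB⟩ := h₁
    cases A with
    | box A => exact ⟨A :: l', rfl⟩
    | _ => cases hB

/-- Equal formulas may carry different labels, so the rearrangement has to be chosen along the
permutation of the labelled lists. -/
theorem exists_exch {X Y : List (LForm L)} (h : X.Perm Y) {l : List Form} {g : ListOcc l → L}
    (hl : labelList l g = Y) :
    ∃ (l' : List Form) (e : Exch l' l), labelList l' (fun o => g (e.map o)) = X := by
  induction h generalizing l with
  | nil =>
    cases l with
    | nil => exact ⟨[], .nil, rfl⟩
    | cons A l => cases hl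
  | cons C _ ih =>
    cases l with
    | nil => cases hl
    | cons A l =>
      obtain ⟨h₁, h₂⟩ := List.cons_eq_cons.1 hl
      obtain ⟨l', e, h₃⟩ := ih h₂
      exact ⟨A :: l', .cons A e, congrArg₂ List.cons h₁ h₃⟩
  | swap C D X =>
    match l, g, hl with
    | [], _, hl => cases hl
    | [A], _, hl => cases hl
    | A :: B :: l, g, hl =>
      cases hl
      exact ⟨B :: A :: l, .swap B A l, rfl⟩
  | trans _ _ ih₁ ih₂ =>
    obtain ⟨l', e, h⟩ := ih₂ hl
    obtain ⟨l'', e', h'⟩ := ih₁ h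
    exact ⟨l'', .trans e' e, h'⟩

/-- `rl` is the rule (⊃□) and introduces the occurrence of `□` in its conclusion. -/
def Rule1.Introduces : {S₁ S : Sequent} → Rule1 S₁ S → SeqOcc S → Prop
  | _, _, .boxR _ _ _ _, o => o = .suc (.head .top)
  | _, _, .impR _ _ _ _, _ => False
  | _, _, .boxL _ _ _, _ => False
  | _, _, .exch _ _, _ => False

variable {k : System} {r : L → L → Prop}

/-- Labellings of a proof and of the conclusion of a further rule, combined. -/
def Occ.extend {S₁ S : Sequent} {rl : Rule1 S₁ S} {d : Proof k S₁} (g : SeqOcc S → L)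
    (f : Occ d → L) : Occ (Proof.unary rl d) → L
  | .root o => g o
  | .up o => f o

/-- Labellings of two proofs and of the conclusion of a further rule, combined. -/
def Occ.extend₂ {S₁ S₂ S : Sequent} {rl : Rule2 k S₁ S₂ S} {d₁ : Proof k S₁} {d₂ : Proof k S₂}
    (g : SeqOcc S → L) (f₁ : Occ d₁ → L) (f₂ : Occ d₂ → L) : Occ (Proof.binary rl d₁ d₂) → L
  | .root o => g o
  | .upLeft o => f₁ o
  | .upRight o => f₂ o

theorem Adequate.extend {S₁ S : Sequent} {rl : Rule1 S₁ S} {d : Proof k S₁} {g : SeqOcc S → L}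
    {f : Occ d → L} (hf : Adequate r d f) (hg : ∀ o, f (.root o) = g (rl.corr o))
    (hr : ∀ o o', rl.Introduces o' → r (f (.root o)) (g o')) :
    Adequate r (Proof.unary rl d) (Occ.extend g f) := by
  constructor
  · intro o o' h
    cases h with
    | unary _ _ o => exact hg o
    | up _ h => exact hf.corr _ _ h
  · intro o o' h
    cases h with
    | boxR A Γ Γ' Δ' _ o => exact hr o _ rfl
    | up _ h => exact hf.prem _ _ h

theorem Adequate.extend₂ {S₁ S₂ S : Sequent} {rl : Rule2 k S₁ S₂ S} {d₁ : Proof k S₁}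
    {d₂ : Proof k S₂} {g : SeqOcc S → L} {f₁ : Occ d₁ → L} {f₂ : Occ d₂ → L}
    (hf₁ : Adequate r d₁ f₁) (hf₂ : Adequate r d₂ f₂)
    (hg : ∀ o o', rl.Corr o o' →
      Occ.extend₂ (rl := rl) g f₁ f₂ o.toOcc = Occ.extend₂ (rl := rl) g f₁ f₂ o'.toOcc) :
    Adequate r (Proof.binary rl d₁ d₂) (Occ.extend₂ g f₁ f₂) := by
  constructor
  · intro o o' h
    cases h with
    | binary _ _ _ o o' h => exact hg o o' h
    | upLeft _ _ h => exact hf₁.corr _ _ h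
    | upRight _ _ h => exact hf₂.corr _ _ h
  · intro o o' h
    cases h with
    | upLeft _ _ h => exact hf₁.prem _ _ h
    | upRight _ _ h => exact hf₂.prem _ _ h

/-- The labelling `g` of the occurrences in a sequent extends to an adequate labelling of one of
its proofs. -/
def Realizable (k : System) (r : L → L → Prop) (S : Sequent) (g : SeqOcc S → L) : Prop :=
  ∃ (d : Proof k S) (f : Occ d → L), (∀ o, f (.root o) = g o) ∧ Adequate r d f

theorem Realizable.nullary {S : Sequent} (rl : Rule0 S) {g : SeqOcc S → L} :
    Realizable k r S g := by
  refine ⟨.nullary rl, fun o => match o with | .root o => g o, fun _ => rfl, ?_, ?_⟩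
  all_goals
    intro o o' h
    cases h

/-- Each occurrence in the premise corresponds to one in the conclusion, so labels propagate upwards
from the conclusion. -/
theorem Realizable.unary {S₁ S : Sequent} (rl : Rule1 S₁ S) {g : SeqOcc S → L}
    (h : Realizable k r S₁ fun o => g (rl.corr o))
    (hr : ∀ o o', rl.Introduces o' → r (g (rl.corr o)) (g o')) : Realizable k r S g := by
  obtain ⟨d, f, hf, ha⟩ := h
  exact ⟨.unary rl d, Occ.extend g f, fun _ => rfl,
    ha.extend hf fun o o' h => by rw [hf]; exact hr o o' h⟩

/-- A labelling of the two sides of a sequent. -/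
def SeqOcc.elim {S : Sequent} (g : ListOcc S.ant → L) (h : ListOcc S.suc → L) : SeqOcc S → L
  | .ant o => g o
  | .suc o => h o

/-- A labelling of a list that is extended by a formula. -/
def ListOcc.cons {A : Form} {l : List Form} (g : BoxOcc A → L) (h : ListOcc l → L) :
    ListOcc (A :: l) → L
  | .head o => g o
  | .tail o => h o

/-- Strict rules are rules of every system, hence `k` is arbitrary. The induction carries a sequent
together with a labelling that yields `X` and `Y`, so that the proof built has exactly the given
root. -/
theorem SDer.realizable {X Y : List (LForm L)} (h : SDer r X Y) {S : Sequent}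
    {g : SeqOcc S → L} (hX : labelList S.ant (fun o => g (.ant o)) = X)
    (hY : labelList S.suc (fun o => g (.suc o)) = Y) : Realizable k r S g := by
  induction h generalizing S with
  | ax P X Y =>
    match S, g, hX, hY with
    | ⟨.atom _ :: Γ, .atom _ :: Δ⟩, g, hX, hY =>
      cases hX
      cases hY
      exact .nullary (.ax P Γ Δ)
  | botL X Y =>
    match S, g, hX, hY with
    | ⟨.bot :: Γ, Δ⟩, g, hX, hY =>
      exact .nullary (.botL Γ Δ)
  | impL _ _ ih₁ ih₂ =>
    match S, g, hX, hY with
    | ⟨.imp A B :: Γ, Δ⟩, g, hX, hY =>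
      cases hX
      cases hY
      obtain ⟨d₁, f₁, hf₁, ha₁⟩ := ih₁ (S := ⟨Γ, A :: Δ⟩)
        (g := SeqOcc.elim (fun o => g (.ant (.tail o)))
          (ListOcc.cons (fun o => g (.ant (.head (.inLeft o)))) fun o => g (.suc o))) rfl rfl
      obtain ⟨d₂, f₂, hf₂, ha₂⟩ := ih₂ (S := ⟨B :: Γ, Δ⟩)
        (g := SeqOcc.elim (ListOcc.cons (fun o => g (.ant (.head (.inRight o))))
          fun o => g (.ant (.tail o))) (fun o => g (.suc o))) rfl rfl
      refine ⟨.binary (.impL k A B Γ Δ) d₁ d₂, Occ.extend₂ g f₁ f₂, fun _ => rfl,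
        ha₁.extend₂ ha₂ fun o o' h => ?_⟩
      cases h with
      | impL_left_ant => exact hf₁ _
      | impL_left_suc => exact hf₁ _
      | impL_left_active => exact hf₁ _
      | impL_right_ant => exact hf₂ _
      | impL_right_suc => exact hf₂ _
      | impL_right_active => exact hf₂ _
  | impR _ ih =>
    match S, g, hX, hY with
    | ⟨Γ, .imp A B :: Δ⟩, g, hX, hY =>
      cases hX
      cases hY
      exact .unary (.impR A B Γ Δ) (ih rfl rfl) fun _ _ h => h.elim
  | boxL _ ih =>
    match S, g, hX, hY with
    | ⟨.box A :: Γ, Δ⟩, g, hX, hY =>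
      cases hX
      cases hY
      exact .unary (.boxL A Γ Δ) (ih rfl rfl) fun _ _ h => h.elim
  | boxR X' Y' h₁ h₂ _ ih =>
    match S, g, hX, hY with
    | ⟨Γ, .box A :: Δ⟩, g, hX, hY =>
      cases hY
      obtain ⟨Γ₁, Γ₂, e, h⟩ := labelList_eq_append (l := Γ) hX
      subst e h
      -- The unlabelled (⊃□) needs its context literally in the form `Γ₁.map Form.box`.
      obtain ⟨Γ₁, rfl⟩ := exists_map_box fun C hC => (h₁ C hC).1
      refine .unary (.boxR A Γ₁ Γ₂ Δ) (ih rfl rfl) ?_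
      rintro o _ rfl
      match o with
      | .ant o => exact forall_below_labelList.1 (fun C hC => (h₁ C hC).2) o
      | .suc (.head o) => exact Form.below_label.1 h₂ o
  | perm hX' hY' _ ih =>
    obtain ⟨Γ, e, h₁⟩ := exists_exch hX' hX
    obtain ⟨Δ, e', h₂⟩ := exists_exch hY' hY
    exact .unary (S₁ := ⟨Γ, Δ⟩) (.exch e e') (ih h₁ h₂) fun _ _ h => h.elim

/-! ### Cycle-free proofs -/

theorem CycleFree.adequate {S : Sequent} (d : Proof k S) :
    Adequate (Relation.TransGen (Prehistoric d)) d Occ.family :=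
  ⟨fun _ _ h => Quot.sound h, fun o o' h => .single ⟨o, o', rfl, rfl, h⟩⟩

/-- The labelling factors through families and sends `≺` into `r`, so a cycle would give a label
below itself. -/
theorem Adequate.cycleFree [IsTrans L r] [Std.Irrefl r] {S : Sequent} {d : Proof k S}
    {f : Occ d → L} (hf : Adequate r d f) : CycleFree d := by
  have key : ∀ i j, Relation.TransGen (Prehistoric d) i j →
      r (Quot.lift f hf.corr i) (Quot.lift f hf.corr j) := by
    intro i j h
    induction h with
    | single h =>
      obtain ⟨o, o', rfl, rfl, h⟩ := h
      exact hf.prem o o' h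
    | tail _ h ih =>
      obtain ⟨o, o', rfl, rfl, h⟩ := h
      exact _root_.trans ih (hf.prem o o' h)
  rintro ⟨i, hi⟩
  exact irrefl _ (key i i hi)

/-- A cycle-free proof in one of the systems gives a cycle-free proof in any other. -/
theorem CycleFree.transfer {k : System} (k' : System) {S : Sequent} {d : Proof k S}
    (hd : CycleFree d) : ∃ d' : Proof k' S, CycleFree d' := by
  -- Cycle-freeness enters only here; the labelled calculus needs transitivity alone.
  have : Std.Irrefl (Relation.TransGen (Prehistoric d)) := ⟨fun i hi => hd ⟨i, hi⟩⟩
  have hs := (CycleFree.adequate d).labelled.strict (fun _ h => .left h) (fun _ h => .right h)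
  obtain ⟨d', f, -, hf⟩ := hs.realizable (k := k') (g := fun o => (Occ.root o).family) rfl rfl
  exact ⟨d', hf.cycleFree⟩

theorem cycleFreeFragment_subset (k k' : System) : cycleFreeFragment k ⊆ cycleFreeFragment k' := by
  rintro _ ⟨Γ, Δ, rfl, d, hd⟩
  exact ⟨Γ, Δ, rfl, hd.transfer k'⟩

/-! ### Polarity in G3s -/

theorem ListOcc.positive_append {l l' : List Form} (o : ListOcc l) :
    (o.append l').Positive ↔ o.Positive := by
  induction o with
  | head => exact .rfl
  | tail _ ih => exact ih

theorem Exch.positive_map {l l' : List Form} (e : Exch l l') (o : ListOcc l) :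
    (e.map o).Positive ↔ o.Positive := by
  induction e with
  | nil => cases o
  | cons A e ih =>
    cases o with
    | head => exact .rfl
    | tail o => exact ih o
  | swap A B l =>
    match o with
    | .head _ => exact .rfl
    | .tail (.head _) => exact .rfl
    | .tail (.tail _) => exact .rfl
  | trans e e' ih ih' => exact (ih' _).trans (ih o)

theorem Rule1.positive_corr {S₁ S : Sequent} (rl : Rule1 S₁ S) (o : SeqOcc S₁) :
    (rl.corr o).Positive ↔ o.Positive := by
  cases rl with
  | impR =>
    match o with
    | .ant (.head _) => exact .rfl
    | .ant (.tail _) => exact .rfl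
    | .suc (.head _) => exact .rfl
    | .suc (.tail _) => exact .rfl
  | boxL =>
    match o with
    | .ant (.head _) => exact .rfl
    | .ant (.tail _) => exact .rfl
    | .suc _ => exact .rfl
  | boxR =>
    match o with
    | .ant o => exact not_congr o.positive_append
    | .suc (.head _) => exact .rfl
  | exch e e' =>
    match o with
    | .ant o => exact not_congr (e.positive_map o)
    | .suc o => exact e'.positive_map o

/-- This is particular to G3s: (Cut) identifies occurrences on opposite sides, and (□Cut) identifies
`A` in `□A` with `A` in `□(A → B)`, of opposite polarity. -/
theorem DirectCorr.positive_iff {S : Sequent} {d : Proof System.g3s S} {o o' : Occ d}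
    (h : DirectCorr o o') : o.Positive ↔ o'.Positive := by
  induction h with
  | unary rl d o => exact (rl.positive_corr o).symm
  | binary rl d₁ d₂ o o' h =>
    cases h with
    -- Moving to the left side and into the premise of `→` reverses polarity twice, leaving a double
    -- negation.
    | impL_left_active =>
      simp [RuleOcc.toOcc, Occ.Positive, SeqOcc.Positive, ListOcc.Positive, BoxOcc.Positive]
    | _ => exact .rfl
  | up _ _ ih => exact ih
  | upLeft _ _ _ ih => exact ih
  | upRight _ _ _ ih => exact ih

theorem PremiseOcc.introduced {S : Sequent} {d : Proof k S} {o o' : Occ d}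
    (h : PremiseOcc o o') : Introduced o' := by
  induction h with
  | boxR A Γ Γ' Δ' d o => exact .boxR A Γ Γ' Δ' d
  | up rl _ ih => exact .up rl ih
  | upLeft rl d₂ _ ih => exact .upLeft rl d₂ ih
  | upRight rl d₁ _ ih => exact .upRight rl d₁ ih

theorem Introduced.positive {S : Sequent} {d : Proof k S} {o : Occ d} (h : Introduced o) :
    o.Positive := by
  induction h with
  | boxR => trivial
  | up _ _ ih => exact ih
  | upLeft _ _ _ ih => exact ih
  | upRight _ _ _ ih => exact ih

theorem Prehistoric.principalPositive {S : Sequent} {d : Proof System.g3s S} {i j : Family d}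
    (h : Prehistoric d i j) : PrincipalPositive d j := by
  obtain ⟨o, o', -, rfl, h⟩ := h
  refine ⟨fun o'' ho => ?_, o', rfl, h.introduced⟩
  have hl : o''.Positive = o'.Positive :=
    congrArg (Quot.lift Occ.Positive fun _ _ h => propext h.positive_iff) ho
  exact hl ▸ h.introduced.positive

/-- Only the first family of a `≺`-chain can fail to be principal positive, and on a cycle it is
also the last. -/
theorem principalCycleFree_iff {S : Sequent} (d : Proof System.g3s S) :
    PrincipalCycleFree d ↔ CycleFree d := by
  refine not_congr (exists_congr fun i => ⟨fun h => h.lift id fun _ _ h => h.2.2, fun h => ?_⟩)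
  have key : ∀ j, PrincipalPositive d i → Relation.TransGen (Prehistoric d) i j →
      Relation.TransGen (PrincipalPrehistoric d) i j ∧ PrincipalPositive d j := by
    intro j hi h
    induction h with
    | single h => exact ⟨.single ⟨hi, h.principalPositive, h⟩, h.principalPositive⟩
    | tail _ h ih => exact ⟨ih.1.tail ⟨ih.2, h.principalPositive, h⟩, h.principalPositive⟩
  -- The last step of the cycle ends in `i`, which makes `i` principal positive.
  obtain ⟨j, -, hj⟩ := Relation.TransGen.tail'_iff.1 h
  exact (key i hj.principalPositive h).1

end G3s

theorem mainTheorem4 :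
    G3s.cycleFreeFragment G3s.System.boxCut = G3s.cycleFreeFragment G3s.System.cut ∧
    G3s.cycleFreeFragment G3s.System.cut = G3s.cycleFreeFragment G3s.System.g3s ∧
    G3s.cycleFreeFragment G3s.System.g3s = G3s.principalCycleFreeFragment := by
  refine ⟨(G3s.cycleFreeFragment_subset _ _).antisymm (G3s.cycleFreeFragment_subset _ _),
    (G3s.cycleFreeFragment_subset _ _).antisymm (G3s.cycleFreeFragment_subset _ _), ?_⟩
  simp only [G3s.cycleFreeFragment, G3s.principalCycleFreeFragment, G3s.principalCycleFree_iff]
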